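/- **Theorem 5 (Non-Adaptive Near-Uniform Identity Testing).** For a distribution $p$ on $[n]=\{1,\dots,n\}$, a conditional sampling oracle for $p$ answers a nonempty query set $S\subseteq[n]$ with a random $i\in S$, returned with probability $p(i)/p(S)$ if $p(S)>0$ and uniformly distributed on $S$ if $p(S)=0$; distinct queries are answered independently. A non-adaptive ($\mathsf{NACOND}$) algorithm is a randomized algorithm that submits all its query sets before it views any of their results. Let $\mathcal U_n$ be the uniform distribution on $[n]$ and $d_{\mathrm{TV}}(p,q)=\frac12\sum_{i\in[n]}|p(i)-q(i)|$. There exists an algorithm which, given $n\ge 1$, $\varepsilon>0$, the description of a distribution $q$ over $[n]$ such that $\|q-\mathcal U_n\|_\infty=\max_{i\in[n]}|q(i)-\tfrac1n|\le\frac{1}{100n}$, and $\mathsf{NACOND}$ access to an unknown distribution $p$ over $[n]$, makes $\tilde O\!\left(\frac{\log n}{\varepsilon^2}\right)$ queries to the oracle for $p$ and distinguishes between the cases $p=q$ and $d_{\mathrm{TV}}(p,q)\ge\varepsilon$ with probability at least $2/3$: if $p=q$ it outputs "$p=q$" with probability at least $2/3$, and if $d_{\mathrm{TV}}(p,q)\ge\varepsilon$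 it outputs "$d_{\mathrm{TV}}(p,q)\ge\varepsilon$" with probability at least $2/3$. Here $\tilde O(g)$ with $g=\frac{\log_2 n}{\varepsilon^2}$ means at most $C\, g\,\bigl(\log_2(2+g)\bigr)^k$ for absolute constants $C$ and $k$, uniformly in $n$, $\varepsilon$, $q$ and $p$. -/

import Mathlib

noncomputable section

namespace NACOND

/-- A query set: a nonempty subset of the domain `[n]`. -/
abbrev QuerySet (n : ℕ) : Type := {S : Finset (Fin n) // S.Nonempty}

open Classical in
/-- The answer of a conditional sampling oracle for `p` to the query `S`: the distribution `p`
conditioned on `S` if `p(S) > 0`, and the uniform distribution on `S` if `p(S) = 0`. -/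
def condSample {n : ℕ} (p : PMF (Fin n)) (S : QuerySet n) : PMF (Fin n) :=
  if h : ∃ i ∈ (S.1 : Set (Fin n)), i ∈ p.support then p.filter (S.1 : Set (Fin n)) h
  else PMF.uniformOfFinset S.1 S.2

/-- The joint law of independent samples, the `i`-th one drawn from `μ i`. -/
def indep {m n : ℕ} (μ : Fin m → PMF (Fin n)) : PMF (Fin m → Fin n) :=
  PMF.ofFintype (fun a => ∏ i, μ i (a i)) (by
    have h := Finset.prod_univ_sum (fun _ : Fin m => (Finset.univ : Finset (Fin n)))
      (fun i x => μ i x)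
    rw [Fintype.piFinset_univ] at h
    rw [← h]
    refine Finset.prod_eq_one fun i _ => ?_
    rw [← tsum_fintype (L := .unconditional _)]
    exact (μ i).tsum_coe)

/-- A randomized algorithm over the domain `[n]` that makes `m` non-adaptive conditional queries:
it draws all its query sets before it sees any answer (`queries` is their joint law), and then gives
a possibly randomized verdict that depends on the query sets and on the answers. The verdict `true`
stands for "`p = q`", the verdict `false` for "`p` is far from `q`". Any internal randomness shared
by the two phases is covered, since only the law of the verdict given the query sets and the answers
matters. -/
structure Tester (n m : ℕ) where
  queries : PMF (Fin m → QuerySet n)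
  verdict : (Fin m → QuerySet n) → (Fin m → Fin n) → PMF Bool

/-- The law of the verdict of the algorithm when the oracle is that of `p`; given the query sets,
the oracle answers the queries independently. -/
def Tester.run {n m : ℕ} (A : Tester n m) (p : PMF (Fin n)) : PMF Bool :=
  A.queries.bind fun S => (indep fun i => condSample p (S i)).bind fun a => A.verdict S a

/-- The total variation distance. -/
def tvDist {n : ℕ} (p q : PMF (Fin n)) : ℝ :=
  1 / 2 * ∑ i, |(p i).toReal - (q i).toReal|

/-- The sup-norm distance from `q` to the uniform distribution on `[n]`. -/
def linftyDistUniform {n : ℕ} (q : PMF (Fin n)) : ℝ :=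
  ‖fun i : Fin n => (q i).toReal - 1 / (n : ℝ)‖

/-- `m = Õ(g)`: up to a constant factor, `m` is at most `g` times a power of `log g`, with absolute
constants, for all domain sizes `n ≥ 1` and all `ε > 0`. The `2 +` only keeps the logarithmic
factor at least `1`. -/
def IsSoftO (m : ℕ → ℝ → ℕ) (g : ℕ → ℝ → ℝ) : Prop :=
  ∃ (C : ℝ) (k : ℕ), ∀ (n : ℕ) (ε : ℝ), 1 ≤ n → 0 < ε →
    (m n ε : ℝ) ≤ C * g n ε * (Real.logb 2 (2 + g n ε)) ^ k

end NACOND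

end

namespace NACOND

/-! Let r = p/q. Under q the ratio r has mean 1, and the positive parts of r - 1 and of 1 - r both
have mean `tvDist p q`. A query S exposes p when p and q, conditioned on S, differ at some point:
the size of the gap dictates how often S is repeated, the rarity of such S how many trials are made.
The point need not be known, since a random test set T sees a constant fraction of the gap with
probability at least 1/2 (`sum_acceptProb_le`).

With q-probability at least 1/2 one has r ≥ 1, or else with that probability r ≤ 1
(`half_le_prob_or`). In the first case the deficit 1 - r is at most 1. A point of deficit at least
2^-(k+1), paired with a point where r ≥ 1, yields a gap of order 2^-k (`NearUniform.pair_gap`),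
visible after about 4^k repetitions; about 2^(K-k) such trials, with 2^-K of order ε, give a cost of
order 4^K over all levels, up to logarithms.

In the second case a bounded excess r - 1 is treated alike, but r can be of order n, and points with
r about s may have probability only ε/s, too rare for pairs. A query made of s samples is s times
likelier to hit one. By Markov the other samples have total ratio at most 2s half of the time, and
then a point of ratio at least 16s dominates the query under p but not under q (`heavy_prob`,
`NearUniform.heavy_gap`). Dyadic values of s give log n further levels, each of about 1/ε trials
with a constant gap.

The tester accepts when all trials do. A union bound covers p = q; otherwise the rejection
probabilities add up to a multiple of the dyadic bound on `tvDist p q`. -/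

theorem sum_toReal {α : Type*} [Fintype α] (μ : PMF α) : ∑ a, (μ a).toReal = 1 := by
  rw [← ENNReal.toReal_sum fun a _ => μ.apply_ne_top a, ← tsum_fintype (L := .unconditional _),
    μ.tsum_coe, ENNReal.toReal_one]

theorem toReal_bind_apply {α β : Type*} [Fintype α] (μ : PMF α) (f : α → PMF β) (b : β) :
    ((μ.bind f) b).toReal = ∑ a, (μ a).toReal * (f a b).toReal := by
  rw [PMF.bind_apply, tsum_fintype, ENNReal.toReal_sum]
  · simp [ENNReal.toReal_mul]
  · exact fun a _ => ENNReal.mul_ne_top (μ.apply_ne_top a) ((f a).apply_ne_top b)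

theorem toReal_indep_apply {m n : ℕ} (μ : Fin m → PMF (Fin n)) (a : Fin m → Fin n) :
    (indep μ a).toReal = ∏ i, (μ i (a i)).toReal := by
  simp [indep, PMF.ofFintype_apply, ENNReal.toReal_prod]

theorem sum_prod_toReal {m n : ℕ} (μ : Fin m → PMF (Fin n)) :
    ∑ a : Fin m → Fin n, ∏ i, (μ i (a i)).toReal = 1 := by
  simpa [toReal_indep_apply] using sum_toReal (indep μ)

/-! ### Conjunctions of independent testers -/

/-- The verdict "`p = q`" of the conjunction of two testers that are run independently. -/
theorem exists_and {n a b : ℕ} (A : Tester n a) (B : Tester n b) :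
    ∃ C : Tester n (a + b), ∀ p : PMF (Fin n),
      (C.run p true).toReal = (A.run p true).toReal * (B.run p true).toReal := by
  refine ⟨⟨A.queries.bind fun S => B.queries.bind fun S' => PMF.pure (Fin.append S S'),
    fun S x => (A.verdict (fun i => S (Fin.castAdd b i)) fun i => x (Fin.castAdd b i)).bind
      fun u => (B.verdict (fun i => S (Fin.natAdd a i)) fun i => x (Fin.natAdd a i)).bind
        fun v => PMF.pure (u && v)⟩, fun p => ?_⟩
  simp only [Tester.run, PMF.bind_bind, PMF.pure_bind, toReal_bind_apply, toReal_indep_apply,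
    Fin.append_left, Fin.append_right, Fintype.sum_bool, PMF.pure_apply]
  rw [Finset.sum_mul_sum]
  refine Finset.sum_congr rfl fun S _ => ?_
  rw [Finset.mul_sum]
  refine Finset.sum_congr rfl fun S' _ => ?_
  rw [mul_mul_mul_comm, Finset.sum_mul_sum, ← mul_assoc]
  congr 1
  rw [← (Fin.appendEquiv a b).sum_comp, Fintype.sum_prod_type]
  refine Finset.sum_congr rfl fun x _ => Finset.sum_congr rfl fun y _ => ?_
  simp only [Fin.appendEquiv, Equiv.coe_fn_mk, Fin.prod_univ_add, Fin.append_left,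
    Fin.append_right]
  simp
  ring

theorem exists_forall {n : ℕ} {ι : Type*} (s : Finset ι) (N : ι → ℕ)
    (A : (i : ι) → Tester n (N i)) (hn : 0 < n) :
    ∃ C : Tester n (∑ i ∈ s, N i), ∀ p : PMF (Fin n),
      (C.run p true).toReal = ∏ i ∈ s, ((A i).run p true).toReal := by
  classical
  induction s using Finset.induction_on with
  | empty =>
    refine ⟨⟨PMF.pure fun _ => ⟨{⟨0, hn⟩}, by simp⟩, fun _ _ => PMF.pure true⟩, fun p => ?_⟩
    simp [Tester.run]
  | insert i s hi ih =>
    obtain ⟨C, hC⟩ := ih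
    rw [Finset.sum_insert hi]
    obtain ⟨D, hD⟩ := exists_and (A i) C
    exact ⟨D, fun p => by rw [hD, hC, Finset.prod_insert hi]⟩

/-! ### A single trial -/

/-- The set of the terms of a nonempty sequence, as a query. -/
noncomputable def querySetOfSeq {n s : ℕ} (hs : 0 < s) (x : Fin s → Fin n) : QuerySet n :=
  ⟨Finset.univ.image x, ⟨x ⟨0, hs⟩, by simp⟩⟩

/-- The mass of `T` under the answer to the query `S`. -/
noncomputable def condMass {n : ℕ} (p : PMF (Fin n)) (S : QuerySet n) (T : Finset (Fin n)) : ℝ :=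
  ∑ i ∈ T, (condSample p S i).toReal

/-- The proportion of the answers `a` that lie in `T`. -/
noncomputable def freq {n N : ℕ} (a : Fin N → Fin n) (T : Finset (Fin n)) : ℝ :=
  (∑ j, if a j ∈ T then 1 else 0) / N

open Classical in
/-- The probability that the proportion of `N` samples from `μ` that lie in `T` is within `τ` of
`c`. -/
noncomputable def acceptProb {n : ℕ} (N : ℕ) (μ : PMF (Fin n)) (T : Finset (Fin n)) (c τ : ℝ) : ℝ :=
  ∑ a : Fin N → Fin n, (∏ j, (μ (a j)).toReal) * if |freq a T - c| < τ then 1 else 0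

/-- The law of the verdict of a single trial: the query is the set of the values of `s` samples from
`q`, it is repeated `N` times, and the proportion of the answers in a random set `T` is compared
with its expectation under `q`. -/
theorem exists_trial {n s N : ℕ} (hs : 0 < s) (hN : 0 < N) (q : PMF (Fin n)) (τ : ℝ) :
    ∃ A : Tester n N, ∀ p : PMF (Fin n), (A.run p true).toReal =
      ∑ x : Fin s → Fin n, (∏ l, (q (x l)).toReal) *
        (∑ T : Finset (Fin n), acceptProb N (condSample p (querySetOfSeq hs x)) T
          (condMass q (querySetOfSeq hs x) T) τ) / 2 ^ n := by
  classical
  refine ⟨⟨(indep fun _ : Fin s => q).bind fun x => PMF.pure fun _ => querySetOfSeq hs x,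
    -- The test set T is drawn only in the verdict. All N queries coincide, so the one with index 0
    -- recovers the query set.
    fun S a => (PMF.uniformOfFintype (Finset (Fin n))).bind fun T =>
      PMF.pure (decide (|freq a T - condMass q (S ⟨0, hN⟩) T| < τ))⟩, fun p => ?_⟩
  simp only [Tester.run, PMF.bind_bind, PMF.pure_bind, toReal_bind_apply, toReal_indep_apply,
    acceptProb]
  refine Finset.sum_congr rfl fun x _ => ?_
  rw [mul_div_assoc]
  congr 1
  simp only [Finset.mul_sum]
  rw [Finset.sum_comm, Finset.sum_div]
  refine Finset.sum_congr rfl fun T _ => ?_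
  rw [Finset.sum_div]
  refine Finset.sum_congr rfl fun a _ => ?_
  simp only [PMF.uniformOfFintype_apply, Fintype.card_finset, Fintype.card_fin, PMF.pure_apply]
  rw [mul_div_assoc]
  congr 1
  by_cases h : |freq a T - condMass q (querySetOfSeq hs x) T| < τ <;> simp [h]

/-! ### Concentration of the empirical frequency -/

theorem sum_prod_eq_pow {n N : ℕ} (f : Fin n → ℝ) :
    ∑ a : Fin N → Fin n, ∏ j, f (a j) = (∑ i, f i) ^ N := by
  have h := Finset.prod_univ_sum (fun _ : Fin N => (Finset.univ : Finset (Fin n))) fun _ x => f x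
  rw [Fintype.piFinset_univ] at h
  simpa using h.symm

/-- Since exp u ≤ 1 + u + u² for |u| ≤ 1 and the indicator is centred, the linear term averages to
zero. -/
theorem sum_mul_exp_le {n : ℕ} (μ : PMF (Fin n)) (T : Finset (Fin n)) {t : ℝ} (ht : |t| ≤ 1) :
    ∑ i, (μ i).toReal * Real.exp (t * ((if i ∈ T then 1 else 0) - ∑ k ∈ T, (μ k).toReal)) ≤
      Real.exp (t ^ 2) := by
  set m := ∑ k ∈ T, (μ k).toReal with hm
  have hm0 : 0 ≤ m := Finset.sum_nonneg fun _ _ => ENNReal.toReal_nonneg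
  have hm1 : m ≤ 1 := by
    rw [← sum_toReal μ]
    exact Finset.sum_le_univ_sum_of_nonneg fun _ => ENNReal.toReal_nonneg
  clear_value m
  have hi : ∀ i, Real.exp (t * ((if i ∈ T then 1 else 0) - m)) ≤
      1 + t * ((if i ∈ T then 1 else 0) - m) + t ^ 2 := by
    intro i
    have hb : |(if i ∈ T then (1 : ℝ) else 0) - m| ≤ 1 := by
      split_ifs <;> rw [abs_le] <;> constructor <;> linarith
    have hb' : |t * ((if i ∈ T then (1 : ℝ) else 0) - m)| ≤ |t| := by
      rw [abs_mul]
      exact mul_le_of_le_one_right (abs_nonneg t) hb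
    have h1 := Real.abs_exp_sub_one_sub_id_le (hb'.trans ht)
    have h2 := (abs_le.mp h1).2
    have h3 := sq_le_sq.mpr hb'
    linarith
  calc _ ≤ ∑ i, (μ i).toReal * (1 + t * ((if i ∈ T then 1 else 0) - m) + t ^ 2) :=
        Finset.sum_le_sum fun i _ => mul_le_mul_of_nonneg_left (hi i) ENNReal.toReal_nonneg
    _ = (1 - t * m + t ^ 2) * (∑ i, (μ i).toReal) +
          t * ∑ i, (if i ∈ T then (μ i).toReal else 0) := by
        rw [Finset.mul_sum, Finset.mul_sum, ← Finset.sum_add_distrib]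
        refine Finset.sum_congr rfl fun i _ => ?_
        split_ifs <;> ring
    _ = t ^ 2 + 1 := by
        rw [sum_toReal, Finset.sum_ite_mem, Finset.univ_inter, ← hm]
        ring
    _ ≤ _ := Real.add_one_le_exp _

theorem sum_prod_mul_exp_le {n N : ℕ} (hN : 0 < N) (μ : PMF (Fin n)) (T : Finset (Fin n)) {t : ℝ}
    (ht : |t| ≤ 1) :
    ∑ a : Fin N → Fin n, (∏ j, (μ (a j)).toReal) *
      Real.exp (t * (N * (freq a T - ∑ k ∈ T, (μ k).toReal))) ≤ Real.exp (N * t ^ 2) := by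
  have hN' : (N : ℝ) ≠ 0 := by positivity
  calc _ = ∑ a : Fin N → Fin n, ∏ j, ((μ (a j)).toReal *
        Real.exp (t * ((if a j ∈ T then 1 else 0) - ∑ k ∈ T, (μ k).toReal))) := by
        refine Finset.sum_congr rfl fun a _ => ?_
        rw [Finset.prod_mul_distrib, ← Real.exp_sum, ← Finset.mul_sum, Finset.sum_sub_distrib]
        simp only [freq, Finset.sum_const, Finset.card_univ, Fintype.card_fin, nsmul_eq_mul]
        congr 3
        field_simp
    _ ≤ Real.exp (t ^ 2) ^ N := by
        rw [sum_prod_eq_pow fun i => (μ i).toReal *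
          Real.exp (t * ((if i ∈ T then 1 else 0) - ∑ k ∈ T, (μ k).toReal))]
        exact pow_le_pow_left₀ (Finset.sum_nonneg fun i _ => by positivity)
          (sum_mul_exp_le μ T ht) N
    _ = _ := by rw [← Real.exp_nat_mul]

open Classical in
-- Chernoff's method with t = ±τ/2, both tails at once: the exponent is Nτ²/4 - Nτ²/2. The bound τ ≤
-- 2 keeps |t| ≤ 1.
theorem tail_le {n N : ℕ} (hN : 0 < N) (μ : PMF (Fin n)) (T : Finset (Fin n)) {τ : ℝ}
    (h0 : 0 ≤ τ) (h1 : τ ≤ 2) :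
    ∑ a : Fin N → Fin n, (∏ j, (μ (a j)).toReal) *
      (if τ ≤ |freq a T - ∑ k ∈ T, (μ k).toReal| then 1 else 0) ≤
      2 * Real.exp (-(N * τ ^ 2 / 4)) := by
  set m := ∑ k ∈ T, (μ k).toReal
  have hp := sum_prod_mul_exp_le hN μ T (t := τ / 2)
    (by rw [abs_le]; constructor <;> linarith)
  have hm := sum_prod_mul_exp_le hN μ T (t := -(τ / 2))
    (by rw [abs_le]; constructor <;> linarith)
  have hind : ∀ a : Fin N → Fin n, (if τ ≤ |freq a T - m| then (1 : ℝ) else 0) ≤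
      Real.exp (-(N * τ ^ 2 / 2)) * (Real.exp (τ / 2 * (N * (freq a T - m))) +
        Real.exp (-(τ / 2) * (N * (freq a T - m)))) := by
    intro a
    rw [mul_add, ← Real.exp_add, ← Real.exp_add]
    split_ifs with h
    · have hNτ : (0 : ℝ) ≤ N * τ := by positivity
      rcases le_abs.mp h with h | h
      · have := Real.one_le_exp (x := -(N * τ ^ 2 / 2) + τ / 2 * (N * (freq a T - m))) (by
          nlinarith [mul_nonneg hNτ (sub_nonneg.mpr h)])
        have := Real.exp_nonneg (-(N * τ ^ 2 / 2) + -(τ / 2) * (N * (freq a T - m)))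
        linarith
      · have := Real.one_le_exp (x := -(N * τ ^ 2 / 2) + -(τ / 2) * (N * (freq a T - m))) (by
          nlinarith [mul_nonneg hNτ (sub_nonneg.mpr h)])
        have := Real.exp_nonneg (-(N * τ ^ 2 / 2) + τ / 2 * (N * (freq a T - m)))
        linarith
    · positivity
  calc _ ≤ ∑ a : Fin N → Fin n, (∏ j, (μ (a j)).toReal) *
        (Real.exp (-(N * τ ^ 2 / 2)) * (Real.exp (τ / 2 * (N * (freq a T - m))) +
        Real.exp (-(τ / 2) * (N * (freq a T - m))))) :=
        Finset.sum_le_sum fun a _ => mul_le_mul_of_nonneg_left (hind a)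
          (Finset.prod_nonneg fun _ _ => ENNReal.toReal_nonneg)
    _ = Real.exp (-(N * τ ^ 2 / 2)) * ((∑ a : Fin N → Fin n, (∏ j, (μ (a j)).toReal) *
          Real.exp (τ / 2 * (N * (freq a T - m)))) + ∑ a : Fin N → Fin n,
          (∏ j, (μ (a j)).toReal) * Real.exp (-(τ / 2) * (N * (freq a T - m)))) := by
        rw [← Finset.sum_add_distrib, Finset.mul_sum]
        exact Finset.sum_congr rfl fun a _ => by ring
    _ ≤ Real.exp (-(N * τ ^ 2 / 2)) * (Real.exp (N * (τ / 2) ^ 2) +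
          Real.exp (N * (-(τ / 2)) ^ 2)) := by gcongr
    _ = _ := by
        rw [neg_sq, ← two_mul, mul_left_comm, ← Real.exp_add]
        congr 2
        ring

theorem acceptProb_le_one {n N : ℕ} (μ : PMF (Fin n)) (T : Finset (Fin n)) (c τ : ℝ) :
    acceptProb N μ T c τ ≤ 1 := by
  rw [← sum_prod_toReal fun _ : Fin N => μ]
  exact Finset.sum_le_sum fun _ _ => mul_le_of_le_one_right
    (Finset.prod_nonneg fun _ _ => ENNReal.toReal_nonneg) (by split_ifs <;> norm_num)

theorem le_acceptProb {n N : ℕ} (hN : 0 < N) (μ : PMF (Fin n)) (T : Finset (Fin n)) {τ : ℝ}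
    (h0 : 0 ≤ τ) (h1 : τ ≤ 2) :
    1 - 2 * Real.exp (-(N * τ ^ 2 / 4)) ≤ acceptProb N μ T (∑ k ∈ T, (μ k).toReal) τ := by
  classical
  rw [sub_le_iff_le_add]
  refine le_trans ?_ (add_le_add_right (tail_le hN μ T h0 h1) _)
  rw [acceptProb, ← Finset.sum_add_distrib]
  refine (sum_prod_toReal fun _ : Fin N => μ).symm.le.trans ?_
  refine Finset.sum_le_sum fun a _ => le_of_eq ?_
  rw [← mul_add]
  by_cases h : |freq a T - ∑ k ∈ T, (μ k).toReal| < τ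
  · simp [h, not_le.mpr h]
  · simp [h, not_lt.mp h]

theorem acceptProb_le {n N : ℕ} (hN : 0 < N) (μ : PMF (Fin n)) (T : Finset (Fin n)) {c τ : ℝ}
    (h0 : 0 ≤ τ) (h1 : τ ≤ 2) (hc : 2 * τ ≤ |(∑ k ∈ T, (μ k).toReal) - c|) :
    acceptProb N μ T c τ ≤ 2 * Real.exp (-(N * τ ^ 2 / 4)) := by
  classical
  refine le_trans (Finset.sum_le_sum fun a _ => mul_le_mul_of_nonneg_left ?_
    (Finset.prod_nonneg fun _ _ => ENNReal.toReal_nonneg)) (tail_le hN μ T h0 h1)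
  by_cases h : |freq a T - c| < τ
  · have h2 := abs_sub_le (∑ k ∈ T, (μ k).toReal) (freq a T) c
    rw [abs_sub_comm _ (freq a T)] at h2
    have h3 : τ ≤ |freq a T - ∑ k ∈ T, (μ k).toReal| := by linarith
    simp [h, h3]
  · simp only [h, if_false]
    split_ifs <;> norm_num

/-! ### Acceptance probability of a trial -/

/-- Under a random set `T`, the masses of two distributions that differ by `4 τ` at some point differ
by `2 τ` with probability at least `1 / 2`. -/
theorem sum_acceptProb_le {n N : ℕ} (hN : 0 < N) (μ ν : PMF (Fin n)) {τ : ℝ}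
    (h0 : 0 ≤ τ) (h1 : τ ≤ 2) (he : 2 * Real.exp (-(N * τ ^ 2 / 4)) ≤ 1 / 2) {i : Fin n}
    (hi : 4 * τ ≤ |(μ i).toReal - (ν i).toReal|) :
    ∑ T : Finset (Fin n), acceptProb N μ T (∑ k ∈ T, (ν k).toReal) τ ≤ 3 / 4 * 2 ^ n := by
  classical
  set f : Finset (Fin n) → ℝ := fun T => acceptProb N μ T (∑ k ∈ T, (ν k).toReal) τ with hf
  -- Adding i to T shifts the difference of the two masses by μ(i) - ν(i), of size at least 4τ, so
  -- it cannot be below 2τ in absolute value for both sets. One of them accepts with probability at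
  -- most 1/2, the other with at most 1.
  have hpair : ∀ T : Finset (Fin n), i ∉ T → f T + f (insert i T) ≤ 3 / 2 := by
    intro T hT
    have hle := fun T => acceptProb_le_one (N := N) μ T (∑ k ∈ T, (ν k).toReal) τ
    have hor : 2 * τ ≤ |(∑ k ∈ T, (μ k).toReal) - ∑ k ∈ T, (ν k).toReal| ∨
        2 * τ ≤ |(∑ k ∈ insert i T, (μ k).toReal) - ∑ k ∈ insert i T, (ν k).toReal| := by
      rw [Finset.sum_insert hT, Finset.sum_insert hT]
      by_contra! h
      have h2 := abs_lt.mp h.1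
      have h3 := abs_lt.mp h.2
      have h4 : |(μ i).toReal - (ν i).toReal| < 4 * τ := by
        rw [abs_lt]; constructor <;> linarith [h2.1, h2.2, h3.1, h3.2]
      linarith
    rcases hor with h | h
    · linarith [acceptProb_le hN μ T h0 h1 h, hle (insert i T)]
    · linarith [acceptProb_le hN μ (insert i T) h0 h1 h, hle T]
  have hsum : ∑ T : Finset (Fin n), f T = ∑ T ∈ (Finset.univ.erase i).powerset,
      (f T + f (insert i T)) := by
    rw [Finset.sum_add_distrib, ← Finset.sum_powerset_insert (Finset.notMem_erase i _),
      Finset.insert_erase (Finset.mem_univ i), Finset.powerset_univ]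
  have hn : 0 < n := i.pos
  rw [hsum]
  refine (Finset.sum_le_card_nsmul _ _ (3 / 2) fun T hT => hpair T fun hiT =>
    Finset.notMem_erase i _ (Finset.mem_powerset.mp hT hiT)).trans (le_of_eq ?_)
  rw [Finset.card_powerset, Finset.card_erase_of_mem (Finset.mem_univ i), Finset.card_univ,
    Fintype.card_fin, nsmul_eq_mul]
  obtain ⟨k, rfl⟩ := Nat.exists_eq_succ_of_ne_zero hn.ne'
  push_cast
  simp only [Nat.succ_eq_add_one, pow_succ]
  ring

/-- A trial accepts `q` with high probability, and it rejects `p` with a quarter of the probability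
that its query `S` has a point at which `p` and `q`, conditioned on `S`, differ by `4 τ`. -/
theorem exists_trial_bounds {n s N : ℕ} (hs : 0 < s) (hN : 0 < N) (q : PMF (Fin n)) {τ : ℝ}
    (h0 : 0 ≤ τ) (h1 : τ ≤ 2) (he : 2 * Real.exp (-(N * τ ^ 2 / 4)) ≤ 1 / 2) :
    ∃ A : Tester n N,
      1 - 2 * Real.exp (-(N * τ ^ 2 / 4)) ≤ (A.run q true).toReal ∧
      ∀ (p : PMF (Fin n)) (G : Finset (Fin s → Fin n)),
        (∀ x ∈ G, ∃ i, 4 * τ ≤ |(condSample p (querySetOfSeq hs x) i).toReal -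
          (condSample q (querySetOfSeq hs x) i).toReal|) →
        (A.run p true).toReal ≤ 1 - (∑ x ∈ G, ∏ l, (q (x l)).toReal) / 4 := by
  classical
  obtain ⟨A, hA⟩ := exists_trial hs hN q τ
  have h2 : (0 : ℝ) < 2 ^ n := by positivity
  refine ⟨A, ?_, fun p G hG => ?_⟩
  · set e := 2 * Real.exp (-(N * τ ^ 2 / 4))
    have h3 : 1 - e = ∑ x : Fin s → Fin n, (∏ l, (q (x l)).toReal) * (1 - e) := by
      rw [← Finset.sum_mul, sum_prod_toReal, one_mul]
    rw [hA, h3]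
    refine Finset.sum_le_sum fun x _ => ?_
    rw [mul_div_assoc]
    refine mul_le_mul_of_nonneg_left ?_ (Finset.prod_nonneg fun _ _ => ENNReal.toReal_nonneg)
    rw [le_div_iff₀ h2]
    have h := Finset.card_nsmul_le_sum (Finset.univ : Finset (Finset (Fin n)))
      (fun T => acceptProb N (condSample q (querySetOfSeq hs x)) T
        (condMass q (querySetOfSeq hs x) T) τ) _ fun T _ => le_acceptProb hN _ T h0 h1
    rw [Finset.card_univ, Fintype.card_finset, Fintype.card_fin, nsmul_eq_mul] at h
    push_cast at h
    linarith
  · have hx : ∀ x : Fin s → Fin n,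
        (∑ T : Finset (Fin n), acceptProb N (condSample p (querySetOfSeq hs x)) T
          (condMass q (querySetOfSeq hs x) T) τ) / 2 ^ n ≤ 1 - if x ∈ G then 1 / 4 else 0 := by
      intro x
      rw [div_le_iff₀ h2]
      split_ifs with hxG
      · obtain ⟨i, hi⟩ := hG x hxG
        have := sum_acceptProb_le hN _ _ h0 h1 he hi
        unfold condMass
        linarith
      · have h := Finset.sum_le_card_nsmul (Finset.univ : Finset (Finset (Fin n)))
          (fun T => acceptProb N (condSample p (querySetOfSeq hs x)) T
            (condMass q (querySetOfSeq hs x) T) τ) _ fun T _ => acceptProb_le_one _ T _ τ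
        rw [Finset.card_univ, Fintype.card_finset, Fintype.card_fin, nsmul_eq_mul] at h
        push_cast at h
        linarith
    rw [hA]
    calc _ ≤ ∑ x : Fin s → Fin n, (∏ l, (q (x l)).toReal) * (1 - if x ∈ G then 1 / 4 else 0) :=
          Finset.sum_le_sum fun x _ => by
            rw [mul_div_assoc]
            exact mul_le_mul_of_nonneg_left (hx x)
              (Finset.prod_nonneg fun _ _ => ENNReal.toReal_nonneg)
      _ = _ := by
          simp only [mul_sub, mul_one, mul_ite, mul_zero]
          rw [Finset.sum_sub_distrib, sum_prod_toReal, Finset.sum_ite_mem, Finset.univ_inter,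
            Finset.sum_div]
          simp only [mul_one_div]

/-! ### Gaps between conditional laws -/

theorem toReal_condSample_apply {n : ℕ} (p : PMF (Fin n)) (S : QuerySet n) {i : Fin n}
    (hi : i ∈ S.1) (h : 0 < ∑ j ∈ S.1, (p j).toReal) :
    (condSample p S i).toReal = (p i).toReal / ∑ j ∈ S.1, (p j).toReal := by
  classical
  have hex : ∃ j ∈ (S.1 : Set (Fin n)), j ∈ p.support := by
    obtain ⟨j, hj, hpj⟩ := Finset.exists_ne_zero_of_sum_ne_zero h.ne'
    exact ⟨j, hj, fun h0 => hpj (by simp [h0])⟩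
  rw [condSample, dif_pos hex, PMF.filter_apply, ENNReal.toReal_mul, ENNReal.toReal_inv,
    tsum_fintype, ENNReal.toReal_sum, div_eq_mul_inv]
  · congr 2
    · simp [hi]
    · rw [← Finset.sum_indicator_subset (fun j => (p j).toReal) (Finset.subset_univ S.1)]
      refine Finset.sum_congr rfl fun j _ => ?_
      simp only [Set.indicator_apply]
      split_ifs <;> simp_all
  · intro j _
    refine ne_top_of_le_ne_top (p.apply_ne_top j) (Set.indicator_le_self' (by simp) j)

/-- With a = q(i), b = q(j), the gap is smallest when p(i) : p(j) = (1+γ)a : b. It then equals γab /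
(((1+γ)a+b)(a+b)), and the denominator is at most 8ab because a and b are nearly equal. -/
theorem pair_gap {n : ℕ} (p q : PMF (Fin n)) (S : QuerySet n) {i j : Fin n} {γ : ℝ}
    (hS : S.1 = {i, j}) (h0 : 0 < γ) (h1 : γ ≤ 1) (hp : 0 < (p i).toReal)
    (hqi : 0 < (q i).toReal) (hqj : 0 < (q j).toReal)
    (hij : 99 * (q i).toReal ≤ 101 * (q j).toReal) (hji : 99 * (q j).toReal ≤ 101 * (q i).toReal)
    (h : (1 + γ) * ((p j).toReal * (q i).toReal) ≤ (p i).toReal * (q j).toReal) :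
    γ / 8 ≤ |(condSample p S i).toReal - (condSample q S i).toReal| := by
  have hne : i ≠ j := by
    rintro rfl
    nlinarith [mul_pos hp hqi, mul_pos h0 (mul_pos hp hqi)]
  have hpj : 0 ≤ (p j).toReal := ENNReal.toReal_nonneg
  have hi : i ∈ S.1 := by simp [hS]
  have hsum : ∀ μ : PMF (Fin n), ∑ k ∈ S.1, (μ k).toReal = (μ i).toReal + (μ j).toReal :=
    fun μ => by rw [hS, Finset.sum_pair hne]
  rw [toReal_condSample_apply p S hi (by rw [hsum]; positivity),
    toReal_condSample_apply q S hi (by rw [hsum]; positivity), hsum, hsum]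
  set a := (q i).toReal
  set b := (q j).toReal
  refine le_trans ?_ (le_abs_self _)
  have h2 : (1 + γ) * a / ((1 + γ) * a + b) ≤ (p i).toReal / ((p i).toReal + (p j).toReal) := by
    rw [div_le_div_iff₀ (by positivity) (by positivity)]
    linarith
  have h3 : γ / 8 ≤ (1 + γ) * a / ((1 + γ) * a + b) - a / (a + b) := by
    rw [div_sub_div _ _ (by positivity) (by positivity), div_le_div_iff₀ (by norm_num)
      (by positivity)]
    have h4 : ((1 + γ) * a + b) * (a + b) ≤ 8 * (a * b) := by
      have : ((1 + γ) * a + b) * (a + b) ≤ (2 * a + b) * (a + b) := by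
        gcongr
        linarith
      nlinarith [mul_le_mul_of_nonneg_left hij hqi.le, mul_le_mul_of_nonneg_left hji hqj.le,
        mul_pos hqi hqj]
    nlinarith [mul_le_mul_of_nonneg_left h4 h0.le]
  linarith

/-- The likelihood ratio. -/
noncomputable def ratio {n : ℕ} (p q : PMF (Fin n)) (i : Fin n) : ℝ :=
  (p i).toReal / (q i).toReal

theorem ratio_nonneg {n : ℕ} (p q : PMF (Fin n)) (i : Fin n) : 0 ≤ ratio p q i := by
  unfold ratio; positivity

/-- Up to a factor `1 ± 1 / 100`, the distribution is uniform. -/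
def NearUniform {n : ℕ} (q : PMF (Fin n)) : Prop :=
  ∀ i, 99 / (100 * (n : ℝ)) ≤ (q i).toReal ∧ (q i).toReal ≤ 101 / (100 * (n : ℝ))

theorem nearUniform_of_linftyDistUniform_le {n : ℕ} {q : PMF (Fin n)}
    (h : linftyDistUniform q ≤ 1 / (100 * (n : ℝ))) : NearUniform q := by
  intro i
  have hn : (0 : ℝ) < n := by exact_mod_cast i.pos
  have h1 := (norm_le_pi_norm (fun i : Fin n => (q i).toReal - 1 / (n : ℝ)) i).trans h
  rw [Real.norm_eq_abs, abs_le] at h1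
  have e : 1 / (100 * (n : ℝ)) = (1 / n) / 100 := by field_simp
  have e1 : 99 / (100 * (n : ℝ)) = 99 / 100 * (1 / n) := by field_simp
  have e2 : 101 / (100 * (n : ℝ)) = 101 / 100 * (1 / n) := by field_simp
  rw [e] at h1
  rw [e1, e2]
  constructor <;> linarith [h1.1, h1.2]

namespace NearUniform

variable {n : ℕ} {q : PMF (Fin n)}

theorem pos (hq : NearUniform q) (i : Fin n) : 0 < (q i).toReal := by
  have hn : (0 : ℝ) < n := by exact_mod_cast i.pos
  exact lt_of_lt_of_le (by positivity) (hq i).1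

theorem ratio_mul (hq : NearUniform q) (p : PMF (Fin n)) (i : Fin n) :
    ratio p q i * (q i).toReal = (p i).toReal :=
  div_mul_cancel₀ _ (hq.pos i).ne'

theorem le_mul (hq : NearUniform q) (i j : Fin n) :
    99 * (q i).toReal ≤ 101 * (q j).toReal := by
  have h1 := (hq i).2
  have h2 := (hq j).1
  have e1 : 99 / (100 * (n : ℝ)) = 99 * (1 / (100 * n)) := by ring
  have e2 : 101 / (100 * (n : ℝ)) = 101 * (1 / (100 * n)) := by ring
  rw [e1] at h2
  rw [e2] at h1
  linarith

theorem ratio_lt (hq : NearUniform q) (p : PMF (Fin n)) (i : Fin n) : ratio p q i < 2 * n := by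
  have hn : (0 : ℝ) < n := by exact_mod_cast i.pos
  have h1 : (p i).toReal ≤ 1 := by
    rw [← sum_toReal p]
    exact Finset.single_le_sum (f := fun i => (p i).toReal) (fun _ _ => ENNReal.toReal_nonneg)
      (Finset.mem_univ i)
  rw [ratio, div_lt_iff₀ (hq.pos i)]
  have h2 : 99 ≤ (q i).toReal * (100 * n) := (div_le_iff₀ (by positivity)).mp (hq i).1
  nlinarith

theorem pair_gap (hq : NearUniform q) (p : PMF (Fin n)) (S : QuerySet n) {i j : Fin n} {γ : ℝ}
    (hS : S.1 = {i, j}) (h0 : 0 < γ) (h1 : γ ≤ 1) (hi : 0 < ratio p q i)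
    (h : (1 + γ) * ratio p q j ≤ ratio p q i) :
    γ / 8 ≤ |(condSample p S i).toReal - (condSample q S i).toReal| := by
  refine NACOND.pair_gap p q S hS h0 h1 ?_ (hq.pos i) (hq.pos j) (hq.le_mul i j) (hq.le_mul j i) ?_
  · rw [← hq.ratio_mul p]
    exact mul_pos hi (hq.pos i)
  · rw [← hq.ratio_mul p, ← hq.ratio_mul p i]
    nlinarith [mul_le_mul_of_nonneg_right h (mul_pos (hq.pos i) (hq.pos j)).le]

/-- Under p the heavy point outweighs the rest of the query at least sevenfold, so it has mass at
least 7/8. Under q the query holds a second point of nearly equal mass, so it has at most 6/8. -/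
theorem heavy_gap (hq : NearUniform q) (p : PMF (Fin n)) {s : ℕ} (hs : 0 < s) (h2 : 2 ≤ s)
    (x : Fin s → Fin n) (j : Fin s) (hj : 16 * s ≤ ratio p q (x j))
    (hl : ∑ l ∈ Finset.univ.erase j, ratio p q (x l) ≤ 2 * s) :
    1 / 8 ≤ |(condSample p (querySetOfSeq hs x) (x j)).toReal -
      (condSample q (querySetOfSeq hs x) (x j)).toReal| := by
  have hs' : (0 : ℝ) < s := by exact_mod_cast hs
  set S := querySetOfSeq hs x
  have hmem : ∀ l, x l ∈ S.1 := fun l => Finset.mem_image_of_mem x (Finset.mem_univ l)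
  obtain ⟨l, hlj⟩ : ∃ l : Fin s, l ≠ j := by
    have : Nontrivial (Fin s) := Fin.nontrivial_iff_two_le.mpr h2
    exact exists_ne j
  -- A repetition of the heavy point would alone exceed the bound 2s.
  have hne : x l ≠ x j := by
    intro he
    have := Finset.single_le_sum (f := fun l => ratio p q (x l))
      (fun l _ => ratio_nonneg p q (x l)) (Finset.mem_erase.mpr ⟨hlj, Finset.mem_univ l⟩)
    simp only [he] at this
    linarith
  have hqj := hq.pos (x j)
  have hpj : (16 * s) * (q (x j)).toReal ≤ (p (x j)).toReal := by
    rw [← hq.ratio_mul p]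
    exact mul_le_mul_of_nonneg_right hj hqj.le
  have hpj0 : 0 < (p (x j)).toReal := lt_of_lt_of_le (by positivity) hpj
  have hsub : S.1 ⊆ insert (x j) ((Finset.univ.erase j).image x) := by
    intro i hi
    obtain ⟨l, -, rfl⟩ := Finset.mem_image.mp hi
    by_cases h : l = j
    · simp [h]
    · exact Finset.mem_insert_of_mem (Finset.mem_image_of_mem x (by simp [h]))
  have hpS : ∑ i ∈ S.1, (p i).toReal ≤
      (p (x j)).toReal + ∑ l ∈ Finset.univ.erase j, (p (x l)).toReal := by
    refine (Finset.sum_le_sum_of_subset_of_nonneg hsub fun _ _ _ => ENNReal.toReal_nonneg).trans ?_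
    by_cases h : x j ∈ (Finset.univ.erase j).image x
    · rw [Finset.insert_eq_of_mem h]
      refine (Finset.sum_image_le_of_nonneg (fun _ _ => ENNReal.toReal_nonneg)).trans ?_
      linarith
    · rw [Finset.sum_insert h]
      gcongr
      exact Finset.sum_image_le_of_nonneg (fun _ _ => ENNReal.toReal_nonneg)
  -- The ratios 16s and 2s give a factor 8, of which near-uniformity, 101/99, leaves at least 7.
  have hrest : 7 * ∑ l ∈ Finset.univ.erase j, (p (x l)).toReal ≤ (p (x j)).toReal := by
    have h3 : 99 * ∑ l ∈ Finset.univ.erase j, (p (x l)).toReal ≤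
        101 * (q (x j)).toReal * ∑ l ∈ Finset.univ.erase j, ratio p q (x l) := by
      rw [Finset.mul_sum, Finset.mul_sum]
      refine Finset.sum_le_sum fun l _ => ?_
      rw [← hq.ratio_mul p]
      nlinarith [mul_le_mul_of_nonneg_left (hq.le_mul (x l) (x j)) (ratio_nonneg p q (x l))]
    nlinarith [mul_le_mul_of_nonneg_left hl hqj.le]
  have hqS : (q (x j)).toReal + (q (x l)).toReal ≤ ∑ i ∈ S.1, (q i).toReal := by
    rw [← Finset.sum_pair (f := fun i => (q i).toReal) hne.symm]
    refine Finset.sum_le_sum_of_subset_of_nonneg ?_ fun _ _ _ => ENNReal.toReal_nonneg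
    intro i hi
    rcases Finset.mem_insert.mp hi with rfl | hi
    · exact hmem j
    · rw [Finset.mem_singleton.mp hi]
      exact hmem l
  have hql := hq.pos (x l)
  have hqS0 : 0 < ∑ i ∈ S.1, (q i).toReal := lt_of_lt_of_le (by positivity) hqS
  have hpS0 : 0 < ∑ i ∈ S.1, (p i).toReal := hpj0.trans_le
    (Finset.single_le_sum (f := fun i => (p i).toReal) (fun _ _ => ENNReal.toReal_nonneg) (hmem j))
  rw [toReal_condSample_apply p S (hmem j) hpS0, toReal_condSample_apply q S (hmem j) hqS0]
  refine le_trans ?_ (le_abs_self _)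
  have h5 : 7 / 8 ≤ (p (x j)).toReal / ∑ i ∈ S.1, (p i).toReal := by
    rw [div_le_div_iff₀ (by norm_num) hpS0]
    linarith
  have h6 : (q (x j)).toReal / ∑ i ∈ S.1, (q i).toReal ≤ 6 / 8 := by
    rw [div_le_div_iff₀ hqS0 (by norm_num)]
    linarith [hq.le_mul (x j) (x l)]
  linarith

end NearUniform

/-! ### Probability that a random query reveals a gap -/

theorem sum_prod_mul_apply {n s : ℕ} (q : PMF (Fin n)) (f : Fin n → ℝ) (l : Fin s) :
    ∑ x : Fin s → Fin n, (∏ m, (q (x m)).toReal) * f (x l) = ∑ i, (q i).toReal * f i := by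
  have h := Finset.prod_univ_sum (fun _ : Fin s => (Finset.univ : Finset (Fin n)))
    fun m i => (q i).toReal * if m = l then f i else 1
  rw [Fintype.piFinset_univ] at h
  rw [Fintype.prod_eq_single l fun m hm => by simp [hm, sum_toReal]] at h
  simp only [Finset.prod_mul_distrib] at h
  simpa using h.symm

open Classical in
theorem pair_prob {n : ℕ} (q : PMF (Fin n)) (P Q : Fin n → Prop) :
    ∑ x : Fin 2 → Fin n with P (x 0) ∧ Q (x 1), ∏ l, (q (x l)).toReal =
      (∑ i with P i, (q i).toReal) * ∑ i with Q i, (q i).toReal := by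
  rw [Finset.sum_filter, Finset.sum_filter, Finset.sum_filter, Finset.sum_mul_sum,
    ← (finTwoArrowEquiv (Fin n)).symm.sum_comp, Fintype.sum_prod_type]
  refine Finset.sum_congr rfl fun i _ => Finset.sum_congr rfl fun j _ => ?_
  by_cases h1 : P i <;> by_cases h2 : Q j <;> simp [h1, h2, finTwoArrowEquiv]

theorem sum_prod_eq_mul_insertNth {n t : ℕ} (q : PMF (Fin n)) (j : Fin (t + 1))
    (f : (Fin (t + 1) → Fin n) → ℝ) :
    ∑ x, (∏ l, (q (x l)).toReal) * f x = ∑ i, (q i).toReal *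
      ∑ y : Fin t → Fin n, (∏ l, (q (y l)).toReal) * f (j.insertNth i y) := by
  rw [← (Fin.insertNthEquiv (fun _ => Fin n) j).sum_comp, Fintype.sum_prod_type]
  refine Finset.sum_congr rfl fun i _ => ?_
  rw [Finset.mul_sum]
  refine Finset.sum_congr rfl fun y _ => ?_
  rw [Fin.prod_univ_succAbove _ j]
  simp [Fin.insertNthEquiv, mul_assoc]

open Classical in
/-- Markov's inequality for a sum of independent copies. -/
theorem markov_sum {n t : ℕ} (q : PMF (Fin n)) {f : Fin n → ℝ} (hf : ∀ i, 0 ≤ f i)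
    (h1 : ∑ i, (q i).toReal * f i ≤ 1) {c : ℝ} (hc : 2 * t ≤ c) (hc0 : 0 < c) :
    1 / 2 ≤ ∑ y : Fin t → Fin n, (∏ l, (q (y l)).toReal) *
      if ∑ l, f (y l) ≤ c then 1 else 0 := by
  have hpt : ∀ y : Fin t → Fin n, 1 - (∑ l, f (y l)) / c ≤ if ∑ l, f (y l) ≤ c then 1 else 0 := by
    intro y
    split_ifs with h
    · have : 0 ≤ (∑ l, f (y l)) / c := div_nonneg (Finset.sum_nonneg fun l _ => hf _) hc0.le
      linarith
    · have : 1 ≤ (∑ l, f (y l)) / c := (one_le_div hc0).mpr (not_le.mp h).le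
      linarith
  refine le_trans ?_ (Finset.sum_le_sum fun y _ => mul_le_mul_of_nonneg_left (hpt y)
    (Finset.prod_nonneg fun _ _ => ENNReal.toReal_nonneg))
  simp only [mul_sub, mul_one, Finset.sum_sub_distrib, sum_prod_toReal fun _ : Fin t => q,
    mul_div_assoc', ← Finset.sum_div, Finset.mul_sum]
  rw [Finset.sum_comm]
  simp only [sum_prod_mul_apply, Finset.sum_const, Finset.card_univ, Fintype.card_fin,
    nsmul_eq_mul]
  have : (t * ∑ i, (q i).toReal * f i) / c ≤ 1 / 2 := by
    rw [div_le_div_iff₀ hc0 two_pos]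
    nlinarith [mul_le_mul_of_nonneg_left h1 (Nat.cast_nonneg (α := ℝ) t)]
  linarith

open Classical in
/-- Among `s` samples from `q`, one has large `f`, and all others together have small `f`, with
probability at least `s / 2` times the probability of a large value. -/
theorem heavy_prob {n s : ℕ} (q : PMF (Fin n)) {f : Fin n → ℝ} (hf : ∀ i, 0 ≤ f i)
    (h1 : ∑ i, (q i).toReal * f i ≤ 1) :
    s * (∑ i with 16 * (s : ℝ) ≤ f i, (q i).toReal) / 2 ≤
      ∑ x : Fin s → Fin n with ∃ j, 16 * (s : ℝ) ≤ f (x j) ∧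
        ∑ l ∈ Finset.univ.erase j, f (x l) ≤ 2 * s, ∏ l, (q (x l)).toReal := by
  obtain _ | t := s
  · simp
  set s := t + 1 with hs
  have hs0 : (0 : ℝ) < s := by rw [hs]; positivity
  set h := ∑ i with 16 * (s : ℝ) ≤ f i, (q i).toReal with hh
  set E : Fin s → (Fin s → Fin n) → Prop := fun j x => 16 * (s : ℝ) ≤ f (x j) ∧
    ∑ l ∈ Finset.univ.erase j, f (x l) ≤ 2 * s with hE
  -- At most one index can be heavy, as a second heavy sample would break the bound on the rest. The
  -- events are thus disjoint and their probabilities add, which yields the factor s.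
  have hdisj : ∀ x j k, E j x → E k x → j = k := by
    intro x j k hj hk
    by_contra hne
    have := Finset.single_le_sum (f := fun l => f (x l)) (fun l _ => hf (x l))
      (Finset.mem_erase.mpr ⟨hne, Finset.mem_univ j⟩)
    linarith [hj.1, hk.2]
  have hind : ∀ x, ∑ j, (if E j x then (1 : ℝ) else 0) ≤ if ∃ j, E j x then 1 else 0 := by
    intro x
    split_ifs with hx
    · obtain ⟨j, hj⟩ := hx
      rw [Fintype.sum_eq_single j fun k hk => if_neg fun hk' => hk (hdisj x k j hk' hj), if_pos hj]
    · push Not at hx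
      simp [hx]
  -- Given the sample at j, the other t = s - 1 are still independent and have expected total at
  -- most t, so Markov applies.
  have hEj : ∀ j, h / 2 ≤ ∑ x : Fin s → Fin n, (∏ l, (q (x l)).toReal) *
      if E j x then 1 else 0 := by
    intro j
    rw [sum_prod_eq_mul_insertNth q j, hh, Finset.sum_filter, Finset.sum_div]
    refine Finset.sum_le_sum fun i _ => ?_
    by_cases hi : 16 * (s : ℝ) ≤ f i
    · rw [if_pos hi, div_eq_mul_one_div]
      refine mul_le_mul_of_nonneg_left ?_ ENNReal.toReal_nonneg
      refine (markov_sum q hf h1 (t := t) (c := 2 * s) (by rw [hs]; push_cast; linarith)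
        (by positivity)).trans (le_of_eq ?_)
      refine Finset.sum_congr rfl fun y _ => ?_
      have hsum : ∑ l ∈ Finset.univ.erase j, f (j.insertNth (α := fun _ => Fin n) i y l) =
          ∑ l, f (y l) := by
        rw [Finset.sum_erase_eq_sub (Finset.mem_univ j), Fin.sum_univ_succAbove _ j]
        simp
      simp only [hE, Fin.insertNth_apply_same, hi, true_and, hsum]
    · rw [if_neg hi, zero_div]
      exact mul_nonneg ENNReal.toReal_nonneg (Finset.sum_nonneg fun y _ => mul_nonneg
        (Finset.prod_nonneg fun _ _ => ENNReal.toReal_nonneg) (by split_ifs <;> norm_num))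
  calc s * h / 2 = ∑ j : Fin s, h / 2 := by
        rw [Finset.sum_const, Finset.card_univ, Fintype.card_fin, nsmul_eq_mul, mul_div_assoc]
    _ ≤ ∑ j : Fin s, ∑ x : Fin s → Fin n, (∏ l, (q (x l)).toReal) *
          (if E j x then 1 else 0) := Finset.sum_le_sum fun j _ => hEj j
    _ = ∑ x : Fin s → Fin n, (∏ l, (q (x l)).toReal) * ∑ j, (if E j x then 1 else 0) := by
        rw [Finset.sum_comm]
        simp only [Finset.mul_sum]
    _ ≤ ∑ x : Fin s → Fin n, (∏ l, (q (x l)).toReal) * (if ∃ j, E j x then 1 else 0) :=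
        Finset.sum_le_sum fun x _ => mul_le_mul_of_nonneg_left (hind x)
          (Finset.prod_nonneg fun _ _ => ENNReal.toReal_nonneg)
    _ = _ := by
        rw [Finset.sum_filter]
        simp only [mul_ite, mul_one, mul_zero, hE]

open Classical in
/-- The probability of an event, as a real number. -/
noncomputable def prob {n : ℕ} (q : PMF (Fin n)) (P : Fin n → Prop) : ℝ :=
  ∑ i with P i, (q i).toReal

theorem prob_nonneg {n : ℕ} (q : PMF (Fin n)) (P : Fin n → Prop) : 0 ≤ prob q P :=
  Finset.sum_nonneg fun _ _ => ENNReal.toReal_nonneg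

open Classical in
theorem prob_eq_sum {n : ℕ} (q : PMF (Fin n)) (P : Fin n → Prop) :
    prob q P = ∑ i, (q i).toReal * if P i then 1 else 0 := by
  rw [prob, Finset.sum_filter]
  simp

/-- This decides which side supplies partners for the pairs: the deficit of p is hunted in the first
case, the excess in the second. -/
theorem half_le_prob_or {n : ℕ} (q : PMF (Fin n)) (f : Fin n → ℝ) :
    1 / 2 ≤ prob q (fun i => 1 ≤ f i) ∨ 1 / 2 ≤ prob q (fun i => f i ≤ 1) := by
  classical
  have h : 1 ≤ prob q (fun i => 1 ≤ f i) + prob q (fun i => f i ≤ 1) := by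
    rw [prob_eq_sum, prob_eq_sum, ← Finset.sum_add_distrib]
    refine (sum_toReal q).symm.le.trans ?_
    refine Finset.sum_le_sum fun i _ => ?_
    have := ENNReal.toReal_nonneg (a := q i)
    rcases le_total 1 (f i) with h | h <;> simp only [h, if_true, mul_one]
    · split_ifs <;> linarith
    · split_ifs <;> linarith
  by_contra! h'
  linarith [h'.1, h'.2]

/-! ### The two families of trials -/

theorem two_mul_exp_le {B N : ℕ} {τ : ℝ} (h : (N : ℝ) * τ ^ 2 / 4 = B) :
    2 * Real.exp (-(N * τ ^ 2 / 4)) ≤ 2 * (1 / 2) ^ B := by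
  rw [h]
  gcongr
  rw [show -(B : ℝ) = B * (-1) by ring, Real.exp_nat_mul]
  gcongr
  rw [Real.exp_neg, one_div]
  exact inv_anti₀ two_pos (by linarith [Real.add_one_le_exp (1 : ℝ)])

/-- A trial with two samples. -/
theorem exists_light_trial {n : ℕ} {q : PMF (Fin n)} (hq : NearUniform q) {B : ℕ} (hB : 2 ≤ B)
    (k : ℕ) :
    ∃ A : Tester n (4 ^ k * 2 ^ 14 * B), 1 - 2 * (1 / 2) ^ B ≤ (A.run q true).toReal ∧
      ∀ p : PMF (Fin n),
        (1 / 2 ≤ prob q (fun i => 1 ≤ ratio p q i) → (A.run p true).toReal ≤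
          1 - prob q (fun i => (1 / 2) ^ (k + 1) ≤ 1 - ratio p q i) / 8) ∧
        (1 / 2 ≤ prob q (fun i => ratio p q i ≤ 1) → (A.run p true).toReal ≤
          1 - prob q (fun i => (1 / 2) ^ (k + 1) ≤ ratio p q i - 1) / 8) := by
  classical
  set γ : ℝ := (1 / 2) ^ (k + 1) with hγ
  have hγ0 : 0 < γ := by positivity
  have hγ1 : γ ≤ 1 := pow_le_one₀ (by norm_num) (by norm_num)
  -- The pair gap γ/8 equals 4τ for τ = γ/32; the number of repetitions makes Nτ²/4 exactly B.
  have hN : ((4 ^ k * 2 ^ 14 * B : ℕ) : ℝ) * (γ / 32) ^ 2 / 4 = B := by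
    have : (4 : ℝ) ^ k * ((1 / 2) ^ k) ^ 2 = 1 := by
      rw [← pow_mul, mul_comm k 2, pow_mul, ← mul_pow]
      norm_num
    rw [hγ, pow_succ]
    push_cast
    linear_combination (B : ℝ) * this
  have hBle : (2 : ℝ) * (1 / 2) ^ B ≤ 1 / 2 := by
    have : (1 / 2 : ℝ) ^ B ≤ (1 / 2) ^ 2 := pow_le_pow_of_le_one (by norm_num) (by norm_num) hB
    linarith
  obtain ⟨A, hA, hA'⟩ := exists_trial_bounds (N := 4 ^ k * 2 ^ 14 * B) (s := 2) two_pos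
    (by positivity) q (τ := γ / 32) (by positivity) (by linarith)
    ((two_mul_exp_le hN).trans hBle)
  refine ⟨A, le_trans (by linarith [two_mul_exp_le hN]) hA, fun p => ⟨fun h => ?_, fun h => ?_⟩⟩
  -- Good pairs satisfy (1+γ)(1-γ) ≤ 1, as `pair_gap` requires. The partner costs a factor 1/2 and
  -- the trial rejects with a quarter of the probability of a good pair, whence 1/8.
  · refine (hA' p (Finset.univ.filter fun x => 1 ≤ ratio p q (x 0) ∧
      γ ≤ 1 - ratio p q (x 1)) fun x hx => ⟨x 0, ?_⟩).trans ?_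
    · obtain ⟨h1, h2⟩ := (Finset.mem_filter.mp hx).2
      refine le_trans (by linarith) (hq.pair_gap p _ (j := x 1) (γ := γ) ?_ hγ0 hγ1
        (by linarith) (by nlinarith))
      ext i
      simp [querySetOfSeq, Fin.exists_fin_two, eq_comm]
    · rw [pair_prob q (fun i => 1 ≤ ratio p q i) fun i => γ ≤ 1 - ratio p q i]
      have := mul_le_mul_of_nonneg_right h
        (prob_nonneg q fun i => γ ≤ 1 - ratio p q i)
      unfold prob at this ⊢
      linarith
  · refine (hA' p (Finset.univ.filter fun x => γ ≤ ratio p q (x 0) - 1 ∧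
      ratio p q (x 1) ≤ 1) fun x hx => ⟨x 0, ?_⟩).trans ?_
    · obtain ⟨h1, h2⟩ := (Finset.mem_filter.mp hx).2
      refine le_trans (by linarith) (hq.pair_gap p _ (j := x 1) (γ := γ) ?_ hγ0 hγ1
        (by linarith) (by nlinarith))
      ext i
      simp [querySetOfSeq, Fin.exists_fin_two, eq_comm]
    · rw [pair_prob q (fun i => γ ≤ ratio p q i - 1) fun i => ratio p q i ≤ 1]
      have := mul_le_mul_of_nonneg_left h
        (prob_nonneg q fun i => γ ≤ ratio p q i - 1)
      unfold prob at this ⊢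
      linarith

theorem NearUniform.sum_mul_ratio {n : ℕ} {q : PMF (Fin n)} (hq : NearUniform q)
    (p : PMF (Fin n)) : ∑ i, (q i).toReal * ratio p q i = 1 := by
  simp only [mul_comm, hq.ratio_mul p, sum_toReal]

/-- A trial with `2 ^ (k + 1)` samples. -/
theorem exists_heavy_trial {n : ℕ} {q : PMF (Fin n)} (hq : NearUniform q) {B : ℕ} (hB : 2 ≤ B)
    (k : ℕ) :
    ∃ A : Tester n (2 ^ 14 * B), 1 - 2 * (1 / 2) ^ B ≤ (A.run q true).toReal ∧
      ∀ p : PMF (Fin n), (A.run p true).toReal ≤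
        1 - 2 ^ (k + 1) * prob q (fun i => 16 * 2 ^ (k + 1) ≤ ratio p q i) / 8 := by
  classical
  have hN : ((2 ^ 14 * B : ℕ) : ℝ) * (1 / 64) ^ 2 / 4 = B := by
    push_cast
    ring
  have hBle : (2 : ℝ) * (1 / 2) ^ B ≤ 1 / 2 := by
    have : (1 / 2 : ℝ) ^ B ≤ (1 / 2) ^ 2 := pow_le_pow_of_le_one (by norm_num) (by norm_num) hB
    linarith
  have hs : 0 < 2 ^ (k + 1) := by positivity
  have hs2 : 2 ≤ 2 ^ (k + 1) := by
    rw [pow_succ]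
    linarith [Nat.one_le_two_pow (n := k)]
  obtain ⟨A, hA, hA'⟩ := exists_trial_bounds (N := 2 ^ 14 * B) hs
    (by positivity) q (τ := 1 / 64) (by norm_num) (by norm_num)
    ((two_mul_exp_le hN).trans hBle)
  refine ⟨A, le_trans (by linarith [two_mul_exp_le hN]) hA, fun p => ?_⟩
  refine (hA' p _ fun x hx => ?_).trans (sub_le_sub_left (div_le_div_of_nonneg_right
    (heavy_prob (s := 2 ^ (k + 1)) q (ratio_nonneg p q) (hq.sum_mul_ratio p).le) (by norm_num)) _)
    |>.trans (le_of_eq ?_)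
  · obtain ⟨j, h1, h2⟩ := (Finset.mem_filter.mp hx).2
    exact ⟨x j, le_trans (by norm_num) (hq.heavy_gap p hs hs2 x j h1 h2)⟩
  · unfold prob
    push_cast
    ring

/-! ### Union bound and dyadic decomposition of the distance -/

theorem one_sub_sum_le_prod {ι : Type*} (s : Finset ι) {a e : ι → ℝ} (h0 : ∀ i, 0 ≤ a i)
    (h1 : ∀ i, a i ≤ 1) (h : ∀ i, 1 - e i ≤ a i) : 1 - ∑ i ∈ s, e i ≤ ∏ i ∈ s, a i := by
  classical
  induction s using Finset.induction_on with
  | empty => simp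
  | insert i s hi ih =>
    rw [Finset.sum_insert hi, Finset.prod_insert hi]
    have h2 : ∏ j ∈ s, a j ≤ 1 := Finset.prod_le_one (fun j _ => h0 j) fun j _ => h1 j
    have h3 := h i
    nlinarith [mul_nonneg (sub_nonneg.mpr (h1 i)) (sub_nonneg.mpr h2)]

/-- The first threshold that y reaches contributes twice itself, which already bounds y; below all
thresholds the remainder (1/2)^K does. -/
theorem dyadic_le {y : ℝ} (h1 : y ≤ 1) (K : ℕ) :
    y ≤ (1 / 2) ^ K + ∑ k ∈ Finset.range K,
      (1 / 2) ^ k * if (1 / 2 : ℝ) ^ (k + 1) ≤ y then 1 else 0 := by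
  induction K with
  | zero => simpa using h1
  | succ K ih =>
    rw [Finset.sum_range_succ]
    have h2 : (0 : ℝ) ≤ ∑ k ∈ Finset.range K,
        (1 / 2) ^ k * if (1 / 2 : ℝ) ^ (k + 1) ≤ y then 1 else 0 :=
      Finset.sum_nonneg fun k _ => by split_ifs <;> positivity
    have h3 : (0 : ℝ) < (1 / 2) ^ (K + 1) := by positivity
    split_ifs with h
    · linarith
    · linarith [not_le.mp h]

theorem dyadic_le_of_lt {r : ℝ} (L : ℕ) (h : r < 16 * 2 ^ (L + 1)) :
    r ≤ 32 + 32 * ∑ k ∈ Finset.range L,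
      2 ^ (k + 1) * if 16 * (2 : ℝ) ^ (k + 1) ≤ r then 1 else 0 := by
  induction L with
  | zero => norm_num at h ⊢; linarith
  | succ L ih =>
    rw [Finset.sum_range_succ]
    have h2 : (0 : ℝ) ≤ ∑ k ∈ Finset.range L,
        2 ^ (k + 1) * if 16 * (2 : ℝ) ^ (k + 1) ≤ r then 1 else 0 :=
      Finset.sum_nonneg fun k _ => by split_ifs <;> positivity
    split_ifs with h'
    · rw [pow_succ 2 (L + 1)] at h
      linarith
    · linarith [ih (not_le.mp h')]

/-- When r ≥ 2, the two-sample level k = 0 is active, and its coefficient 64 absorbs the constant 32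
left by `dyadic_le_of_lt`. This bridges the range of r between the two families. -/
theorem dyadic_le_add {r : ℝ} {K : ℕ} (hK : 0 < K) (L : ℕ) (h : r < 16 * 2 ^ (L + 1)) :
    max (r - 1) 0 ≤ (1 / 2) ^ K + 64 * (∑ k ∈ Finset.range K,
      (1 / 2) ^ k * if (1 / 2 : ℝ) ^ (k + 1) ≤ r - 1 then 1 else 0) +
      32 * ∑ k ∈ Finset.range L, 2 ^ (k + 1) * if 16 * (2 : ℝ) ^ (k + 1) ≤ r then 1 else 0 := by
  have h0 : (0 : ℝ) ≤ ∑ k ∈ Finset.range K,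
      (1 / 2) ^ k * if (1 / 2 : ℝ) ^ (k + 1) ≤ r - 1 then 1 else 0 :=
    Finset.sum_nonneg fun k _ => by split_ifs <;> positivity
  have h2 : (0 : ℝ) ≤ ∑ k ∈ Finset.range L,
      2 ^ (k + 1) * if 16 * (2 : ℝ) ^ (k + 1) ≤ r then 1 else 0 :=
    Finset.sum_nonneg fun k _ => by split_ifs <;> positivity
  have h3 : (0 : ℝ) < (1 / 2) ^ K := by positivity
  refine max_le ?_ (by positivity)
  rcases le_total (r - 1) 1 with h1 | h1
  · linarith [dyadic_le h1 K]
  · have h4 := Finset.single_le_sum (f := fun k : ℕ => (1 / 2 : ℝ) ^ k *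
      if (1 / 2 : ℝ) ^ (k + 1) ≤ r - 1 then 1 else 0) (fun k _ => by split_ifs <;> positivity)
      (Finset.mem_range.mpr hK)
    have h5 : (1 / 2 : ℝ) ≤ r - 1 := by linarith
    simp only [pow_zero, zero_add, pow_one, h5, if_true, mul_one] at h4
    linarith [dyadic_le_of_lt L h]

open Classical in
theorem sum_mul_sum_ite {n : ℕ} (q : PMF (Fin n)) (K : ℕ) (c : ℕ → ℝ) (P : ℕ → Fin n → Prop) :
    ∑ i, (q i).toReal * ∑ k ∈ Finset.range K, (c k * if P k i then 1 else 0) =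
      ∑ k ∈ Finset.range K, c k * prob q (P k) := by
  simp only [Finset.mul_sum, prob_eq_sum]
  rw [Finset.sum_comm]
  exact Finset.sum_congr rfl fun k _ => Finset.sum_congr rfl fun i _ => by ring

namespace NearUniform

variable {n : ℕ} {q : PMF (Fin n)}

theorem sum_mul_max_ratio_sub_one (hq : NearUniform q) (p : PMF (Fin n)) :
    ∑ i, (q i).toReal * max (ratio p q i - 1) 0 = tvDist p q := by
  have h : ∀ i, (q i).toReal * max (ratio p q i - 1) 0 =
      1 / 2 * (|(p i).toReal - (q i).toReal| + (p i).toReal - (q i).toReal) := by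
    intro i
    rw [mul_max_of_nonneg _ _ (hq.pos i).le, mul_sub, mul_comm _ (ratio p q i), hq.ratio_mul,
      mul_one, mul_zero]
    rcases le_total ((p i).toReal - (q i).toReal) 0 with h | h
    · rw [max_eq_right h, abs_of_nonpos h]; ring
    · rw [max_eq_left h, abs_of_nonneg h]; ring
  rw [Finset.sum_congr rfl fun i _ => h i, ← Finset.mul_sum, Finset.sum_sub_distrib,
    Finset.sum_add_distrib, sum_toReal, sum_toReal, tvDist]
  ring

theorem sum_mul_max_one_sub_ratio (hq : NearUniform q) (p : PMF (Fin n)) :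
    ∑ i, (q i).toReal * max (1 - ratio p q i) 0 = tvDist p q := by
  have h : ∀ i, (q i).toReal * max (1 - ratio p q i) 0 =
      (q i).toReal * max (ratio p q i - 1) 0 + ((q i).toReal - (q i).toReal * ratio p q i) := by
    intro i
    rcases le_total (ratio p q i) 1 with h | h
    · rw [max_eq_left (by linarith), max_eq_right (by linarith)]; ring
    · rw [max_eq_right (by linarith), max_eq_left (by linarith)]; ring
  rw [Finset.sum_congr rfl fun i _ => h i, Finset.sum_add_distrib, hq.sum_mul_max_ratio_sub_one,
    Finset.sum_sub_distrib, sum_toReal, hq.sum_mul_ratio]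
  ring

theorem tvDist_le_of_ratio_le (hq : NearUniform q) (p : PMF (Fin n)) (K : ℕ) :
    tvDist p q ≤ (1 / 2) ^ K + ∑ k ∈ Finset.range K,
      (1 / 2) ^ k * prob q (fun i => (1 / 2) ^ (k + 1) ≤ 1 - ratio p q i) := by
  classical
  have hle : ∀ i, max (1 - ratio p q i) 0 ≤ (1 / 2) ^ K + ∑ k ∈ Finset.range K,
      (1 / 2) ^ k * if (1 / 2 : ℝ) ^ (k + 1) ≤ 1 - ratio p q i then 1 else 0 := fun i =>
    max_le (dyadic_le (by linarith [ratio_nonneg p q i]) K) (add_nonneg (by positivity)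
      (Finset.sum_nonneg fun k _ => by split_ifs <;> positivity))
  rw [← hq.sum_mul_max_one_sub_ratio, ← sum_mul_sum_ite q K (fun k => (1 / 2) ^ k)
    fun k i => (1 / 2) ^ (k + 1) ≤ 1 - ratio p q i]
  calc _ ≤ _ := Finset.sum_le_sum fun i _ => mul_le_mul_of_nonneg_left (hle i) (hq.pos i).le
    _ = _ := by
        simp only [mul_add, Finset.sum_add_distrib, ← Finset.sum_mul, sum_toReal, one_mul]

theorem tvDist_le_of_le_ratio (hq : NearUniform q) (p : PMF (Fin n)) {K : ℕ} (hK : 0 < K) :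
    tvDist p q ≤ (1 / 2) ^ K + 64 * (∑ k ∈ Finset.range K,
      (1 / 2) ^ k * prob q (fun i => (1 / 2) ^ (k + 1) ≤ ratio p q i - 1)) +
      32 * ∑ k ∈ Finset.range (Nat.log 2 n),
        2 ^ (k + 1) * prob q (fun i => 16 * 2 ^ (k + 1) ≤ ratio p q i) := by
  classical
  -- Ratios stay below 2n, so log₂ n heavy levels exhaust them.
  have hlt : ∀ i, ratio p q i < 16 * 2 ^ (Nat.log 2 n + 1) := by
    intro i
    have h1 : (n : ℝ) < 2 ^ (Nat.log 2 n + 1) := by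
      exact_mod_cast Nat.lt_pow_succ_log_self one_lt_two n
    linarith [hq.ratio_lt p i, Nat.cast_nonneg (α := ℝ) n]
  rw [← hq.sum_mul_max_ratio_sub_one, ← sum_mul_sum_ite q K (fun k => (1 / 2) ^ k)
    fun k i => (1 / 2) ^ (k + 1) ≤ ratio p q i - 1, ← sum_mul_sum_ite q (Nat.log 2 n)
    (fun k => 2 ^ (k + 1)) fun k i => 16 * 2 ^ (k + 1) ≤ ratio p q i]
  calc _ ≤ _ := Finset.sum_le_sum fun i _ => mul_le_mul_of_nonneg_left
        (dyadic_le_add hK _ (hlt i)) (hq.pos i).le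
    _ = _ := by
        simp only [mul_add, Finset.sum_add_distrib, ← Finset.sum_mul, sum_toReal, one_mul,
          mul_left_comm _ (64 : ℝ), mul_left_comm _ (32 : ℝ), ← Finset.mul_sum]

end NearUniform

/-! ### Trial counts, query budget and total error -/

/-- The number of trials at each level: `K` levels of trials with two samples, `L` levels of trials
with more samples. -/
def trialCount (K L : ℕ) : Fin K ⊕ Fin L → ℕ :=
  Sum.elim (fun k => 1024 * 2 ^ (K - k)) fun _ => 1024 * 2 ^ K

/-- The number of queries of a trial at each level. -/
def trialQueries (K L B : ℕ) : Fin K ⊕ Fin L → ℕ :=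
  Sum.elim (fun k => 4 ^ (k : ℕ) * 2 ^ 14 * B) fun _ => 2 ^ 14 * B

/-- The total number of queries. -/
def totalQueries (K L B : ℕ) : ℕ :=
  ∑ t : (l : Fin K ⊕ Fin L) × Fin (trialCount K L l), trialQueries K L B t.1

theorem two_pow_sub {K k : ℕ} (h : k < K) : (2 : ℝ) ^ (K - k) = 2 ^ K * (1 / 2) ^ k := by
  rw [pow_sub₀ _ two_ne_zero h.le, one_div, inv_pow]

/-- The trial counts are proportional to the level weights in the dyadic bounds, so rejection
probabilities summed over trials compare directly with the distance. -/
theorem sum_trialCount_mul (K L : ℕ) (f g : ℕ → ℝ) :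
    ∑ t : (l : Fin K ⊕ Fin L) × Fin (trialCount K L l),
      Sum.elim (fun k : Fin K => f k) (fun k : Fin L => g k) t.1 =
    1024 * 2 ^ K * (∑ k ∈ Finset.range K, (1 / 2) ^ k * f k + ∑ k ∈ Finset.range L, g k) := by
  rw [Fintype.sum_sigma]
  simp only [Finset.sum_const, Finset.card_univ, Fintype.card_fin, nsmul_eq_mul,
    Fintype.sum_sum_type]
  simp only [trialCount, Sum.elim_inl, Sum.elim_inr]
  rw [mul_add, Finset.mul_sum, Finset.mul_sum, ← Fin.sum_univ_eq_sum_range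
    (fun k => 1024 * 2 ^ K * ((1 / 2) ^ k * f k)), ← Fin.sum_univ_eq_sum_range
    (fun k => 1024 * 2 ^ K * g k)]
  push_cast
  congr 1
  refine Finset.sum_congr rfl fun k _ => ?_
  rw [two_pow_sub k.2]
  ring

/-- A light level uses 2^(K-k) · 4^k = 2^K · 2^k queries up to constants, a geometric sum of order
4^K. The constant is 2^10 · 2^14. -/
theorem totalQueries_le (K L B : ℕ) :
    (totalQueries K L B : ℝ) ≤ 2 ^ 24 * B * 4 ^ K * (1 + L) := by
  have h1 : (totalQueries K L B : ℝ) = 1024 * 2 ^ K * (∑ k ∈ Finset.range K,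
      (1 / 2) ^ k * (4 ^ k * 2 ^ 14 * (B : ℝ)) + ∑ k ∈ Finset.range L, 2 ^ 14 * (B : ℝ)) := by
    rw [← sum_trialCount_mul, totalQueries, Nat.cast_sum]
    refine Finset.sum_congr rfl fun t _ => ?_
    obtain ⟨l | l, t⟩ := t <;>
      simp only [trialQueries, Sum.elim_inl, Sum.elim_inr, Nat.cast_mul, Nat.cast_pow,
        Nat.cast_ofNat]
  have h2 : ∑ k ∈ Finset.range K, (1 / 2 : ℝ) ^ k * (4 ^ k * 2 ^ 14 * (B : ℝ)) =
      2 ^ 14 * (B : ℝ) * (2 ^ K - 1) := by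
    have h3 := geom_sum_eq (x := (2 : ℝ)) (by norm_num) K
    rw [show (2 : ℝ) ^ K - 1 = (2 ^ K - 1) / (2 - 1) by norm_num, ← h3, Finset.mul_sum]
    refine Finset.sum_congr rfl fun k _ => ?_
    have : (1 / 2 : ℝ) ^ k * 4 ^ k = 2 ^ k := by
      rw [← mul_pow]
      norm_num
    rw [← this]
    ring
  rw [h1, h2, Finset.sum_const, Finset.card_range, nsmul_eq_mul]
  have h4 : (4 : ℝ) ^ K = 2 ^ K * 2 ^ K := by
    rw [← mul_pow]
    norm_num
  have h5 : (1 : ℝ) ≤ 2 ^ K := one_le_pow₀ (by norm_num)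
  rw [h4]
  have h6 : (0 : ℝ) ≤ B * 2 ^ K := by positivity
  have h7 : (2 : ℝ) ^ K - 1 + L ≤ 2 ^ K * (1 + L) := by
    nlinarith [Nat.cast_nonneg (α := ℝ) L]
  nlinarith [mul_le_mul_of_nonneg_left h7 h6]

/-- There are at most 2^10 · 2^K · (L+2) trials. Of the 13 extra halvings, 10 cancel 1024, one the
factor 2, and two leave 1/4. -/
theorem sum_error_le {K L B : ℕ} (hB : K + Nat.clog 2 (L + 2) + 13 ≤ B) :
    ∑ _t : (l : Fin K ⊕ Fin L) × Fin (trialCount K L l), (2 : ℝ) * (1 / 2) ^ B ≤ 1 / 3 := by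
  set e : ℝ := 2 * (1 / 2) ^ B with he
  have h1 := sum_trialCount_mul K L (fun _ => e) fun _ => e
  have h2 : ∀ l : Fin K ⊕ Fin L, Sum.elim (fun _ : Fin K => e) (fun _ : Fin L => e) l = e := by
    rintro (l | l) <;> rfl
  simp only [h2] at h1
  rw [h1, ← Finset.sum_mul, Finset.sum_const, Finset.card_range, nsmul_eq_mul]
  have h3 : ∑ k ∈ Finset.range K, (1 / 2 : ℝ) ^ k ≤ 2 := sum_geometric_two_le K
  have h4 : ((L : ℝ) + 2) ≤ 2 ^ Nat.clog 2 (L + 2) := by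
    exact_mod_cast Nat.le_pow_clog one_lt_two (L + 2)
  have h5 : e ≤ 2 * (1 / 2) ^ (K + Nat.clog 2 (L + 2) + 13) := by
    rw [he]
    gcongr ?_ * ?_
    exact pow_le_pow_of_le_one (by norm_num) (by norm_num) hB
  have he0 : 0 ≤ e := by positivity
  calc _ ≤ 1024 * 2 ^ K * (2 * e + L * e) := by gcongr
    _ = 1024 * 2 ^ K * (L + 2) * e := by ring
    _ ≤ 1024 * 2 ^ K * 2 ^ Nat.clog 2 (L + 2) *
        (2 * (1 / 2) ^ (K + Nat.clog 2 (L + 2) + 13)) := by gcongr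
    _ = 1 / 4 * ((2 * (1 / 2)) ^ K * (2 * (1 / 2)) ^ Nat.clog 2 (L + 2)) := by
        rw [pow_add, pow_add, mul_pow, mul_pow]
        ring
    _ ≤ 1 / 3 := by norm_num

/-! ### The combined tester -/

theorem exists_tester {n : ℕ} (hn : 0 < n) {q : PMF (Fin n)} (hq : NearUniform q) {K B : ℕ}
    (hK : 0 < K) (hB : K + Nat.clog 2 (Nat.log 2 n + 2) + 13 ≤ B) {ε : ℝ}
    (hε : 2 * (1 / 2) ^ K ≤ ε) :
    ∃ A : Tester n (totalQueries K (Nat.log 2 n) B), 2 / 3 ≤ (A.run q true).toReal ∧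
      ∀ p : PMF (Fin n), ε ≤ tvDist p q → (A.run p true).toReal ≤ 1 / 3 := by
  unfold totalQueries
  set L := Nat.log 2 n
  have hB2 : 2 ≤ B := by omega
  choose A hA hA' using fun k => exists_light_trial hq hB2 k
  choose A₂ hA₂ hA₂' using fun k => exists_heavy_trial hq hB2 k
  let T : (l : Fin K ⊕ Fin L) → Tester n (trialQueries K L B l) := fun l =>
    match l with
    | .inl k => A k
    | .inr k => A₂ k
  obtain ⟨C, hC⟩ := exists_forall Finset.univ
    (fun t : (l : Fin K ⊕ Fin L) × Fin (trialCount K L l) => trialQueries K L B t.1)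
    (fun t => T t.1) hn
  have hle : ∀ (p : PMF (Fin n)) (f g : ℕ → ℝ),
      (∀ k, ((A k).run p true).toReal ≤ 1 - f k / 8) →
      (∀ k, ((A₂ k).run p true).toReal ≤ 1 - g k / 8) →
      1 / 64 * (1 / 2) ^ K ≤
        ∑ k ∈ Finset.range K, (1 / 2) ^ k * f k + ∑ k ∈ Finset.range L, g k →
      (C.run p true).toReal ≤ 1 / 3 := by
    intro p f g hf hg h
    have h1 : (C.run p true).toReal ≤ Real.exp (-2) := by
      rw [hC]
      calc _ ≤ ∏ t : (l : Fin K ⊕ Fin L) × Fin (trialCount K L l),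
            Real.exp (-(1 / 8) *
              Sum.elim (fun k : Fin K => f k) (fun k : Fin L => g k) t.1) := by
            refine Finset.prod_le_prod (fun _ _ => ENNReal.toReal_nonneg) fun t _ => ?_
            obtain ⟨l | l, t⟩ := t
            · refine (hf l).trans (le_trans ?_ (Real.add_one_le_exp _))
              simp only [Sum.elim_inl]
              linarith
            · refine (hg l).trans (le_trans ?_ (Real.add_one_le_exp _))
              simp only [Sum.elim_inr]
              linarith
        _ ≤ _ := by
            rw [← Real.exp_sum, ← Finset.mul_sum, sum_trialCount_mul]
            refine Real.exp_le_exp.mpr ?_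
            have h2 : (2 : ℝ) ^ K * (1 / 2) ^ K = 1 := by
              rw [← mul_pow]
              norm_num
            -- The exponent is at most -(1/8) · 1024 · (1/64) = -2.
            nlinarith [mul_le_mul_of_nonneg_left h (pow_nonneg (zero_le_two (α := ℝ)) K)]
    have h2 : (3 : ℝ) ≤ Real.exp 2 := by linarith [Real.add_one_le_exp (2 : ℝ)]
    rw [Real.exp_neg] at h1
    exact h1.trans (by rw [one_div]; exact inv_anti₀ (by norm_num) h2)
  refine ⟨C, ?_, fun p hp => ?_⟩
  · have h1 := one_sub_sum_le_prod
      (Finset.univ : Finset ((l : Fin K ⊕ Fin L) × Fin (trialCount K L l)))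
      (a := fun t => ((T t.1).run q true).toReal) (e := fun _ => 2 * (1 / 2) ^ B)
      (fun _ => ENNReal.toReal_nonneg)
      (fun t => ENNReal.toReal_le_of_le_ofReal zero_le_one
        (by simpa using PMF.coe_le_one _ true)) (by
        rintro ⟨l | l, t⟩
        · exact hA l
        · exact hA₂ l)
    rw [hC]
    linarith [sum_error_le (L := L) hB]
  · have hpow : (0 : ℝ) < (1 / 2) ^ K := by positivity
    have hheavy : 0 ≤ ∑ k ∈ Finset.range L,
        2 ^ (k + 1) * prob q (fun i => 16 * 2 ^ (k + 1) ≤ ratio p q i) :=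
      Finset.sum_nonneg fun k _ => mul_nonneg (by positivity) (prob_nonneg _ _)
    -- Since ε ≥ 2 · 2^-K, at least 2^-K of the distance survives the truncation. The factor 64 in
    -- the second case explains the 1/64 in `hle`.
    rcases half_le_prob_or q (ratio p q) with h | h
    · refine hle p (fun k => prob q (fun i => (1 / 2) ^ (k + 1) ≤ 1 - ratio p q i)) _
        (fun k => (hA' k p).1 h) (fun k => hA₂' k p) ?_
      linarith [hq.tvDist_le_of_ratio_le p K]
    · refine hle p (fun k => prob q (fun i => (1 / 2) ^ (k + 1) ≤ ratio p q i - 1)) _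
        (fun k => (hA' k p).2 h) (fun k => hA₂' k p) ?_
      have h0 : 0 ≤ ∑ k ∈ Finset.range K,
          (1 / 2) ^ k * prob q (fun i => (1 / 2) ^ (k + 1) ≤ ratio p q i - 1) :=
        Finset.sum_nonneg fun k _ => mul_nonneg (by positivity) (prob_nonneg _ _)
      linarith [hq.tvDist_le_of_le_ratio p hK]

/-! ### Choice of parameters and query complexity -/

theorem tvDist_le_one {n : ℕ} (p q : PMF (Fin n)) : tvDist p q ≤ 1 := by
  have h : ∑ i, |(p i).toReal - (q i).toReal| ≤ ∑ i, ((p i).toReal + (q i).toReal) :=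
    Finset.sum_le_sum fun i _ => abs_le.mpr ⟨by
      linarith [ENNReal.toReal_nonneg (a := p i)], by
      linarith [ENNReal.toReal_nonneg (a := q i)]⟩
  rw [Finset.sum_add_distrib, sum_toReal, sum_toReal] at h
  rw [tvDist]
  linarith

theorem tvDist_eq_zero_of_le_one {n : ℕ} (hn : n ≤ 1) (p q : PMF (Fin n)) : tvDist p q = 0 := by
  have h := (sum_toReal p).trans (sum_toReal q).symm
  interval_cases n
  · simp [tvDist]
  · simp only [Fin.sum_univ_one] at h
    simp [tvDist, h]

theorem two_thirds_le_apply {x : ENNReal} (hx : x ≠ ⊤) (h : 2 / 3 ≤ x.toReal) : 2 / 3 ≤ x := by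
  rw [← ENNReal.ofReal_le_iff_le_toReal hx] at h
  rwa [ENNReal.ofReal_div_of_pos (by norm_num), ENNReal.ofReal_ofNat, ENNReal.ofReal_ofNat] at h

/-- The number of dyadic scales between the accuracy `ε` and `1`. -/
noncomputable def scales (ε : ℝ) : ℕ := Nat.clog 2 ⌈2 / ε⌉₊

theorem scales_pos {ε : ℝ} (h0 : 0 < ε) (h1 : ε ≤ 1) : 0 < scales ε := by
  refine Nat.clog_pos one_lt_two ?_
  have h2 : (2 : ℝ) ≤ ⌈2 / ε⌉₊ := le_trans ((le_div_iff₀ h0).mpr (by linarith)) (Nat.le_ceil _)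
  exact_mod_cast h2

theorem two_mul_half_pow_scales_le {ε : ℝ} (h0 : 0 < ε) : 2 * (1 / 2) ^ scales ε ≤ ε := by
  have h2 : 2 / ε ≤ 2 ^ scales ε :=
    (Nat.le_ceil _).trans (by exact_mod_cast Nat.le_pow_clog one_lt_two ⌈2 / ε⌉₊)
  rw [one_div, inv_pow, ← div_eq_mul_inv, div_le_iff₀ (by positivity)]
  rw [div_le_iff₀ h0] at h2
  linarith

theorem two_pow_scales_le {ε : ℝ} (h0 : 0 < ε) (h1 : ε ≤ 1) : 2 ^ scales ε ≤ 4 / ε := by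
  have hK := scales_pos h0 h1
  have h2 : (2 : ℝ) ≤ ⌈2 / ε⌉₊ := le_trans ((le_div_iff₀ h0).mpr (by linarith)) (Nat.le_ceil _)
  have h3 : 2 ^ (scales ε).pred < ⌈2 / ε⌉₊ :=
    Nat.pow_pred_clog_lt_self one_lt_two (by exact_mod_cast h2)
  have h4 : (2 : ℝ) ^ (scales ε).pred < 2 / ε := by
    have := Nat.lt_ceil.mp h3
    exact_mod_cast this
  obtain ⟨k, hk⟩ := Nat.exists_eq_succ_of_ne_zero hK.ne'
  rw [hk] at h4 ⊢
  rw [Nat.pred_succ] at h4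
  rw [Nat.succ_eq_add_one, pow_succ]
  have : 4 / ε = 2 / ε * 2 := by ring
  linarith

/-- The factor by which the queries of a trial are repeated. -/
noncomputable def repetitions (n : ℕ) (ε : ℝ) : ℕ :=
  scales ε + Nat.clog 2 (Nat.log 2 n + 2) + 13

open Classical in
/-- The number of queries of the tester. -/
noncomputable def queryCount (n : ℕ) (ε : ℝ) : ℕ :=
  if 2 ≤ n ∧ ε ≤ 1 then totalQueries (scales ε) (Nat.log 2 n) (repetitions n ε) else 0

theorem clog_le_logb_add_one {a : ℕ} (ha : 1 < a) :
    (Nat.clog 2 a : ℝ) ≤ Real.logb 2 a + 1 := by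
  have h := Nat.pow_pred_clog_lt_self one_lt_two ha
  obtain ⟨k, hk⟩ := Nat.exists_eq_succ_of_ne_zero (Nat.clog_pos one_lt_two ha).ne'
  rw [hk, Nat.pred_succ] at h
  have h1 : (k : ℝ) ≤ Real.logb 2 a := by
    rw [Real.le_logb_iff_rpow_le one_lt_two (by positivity), Real.rpow_natCast]
    exact_mod_cast h.le
  rw [hk]
  push_cast
  linarith

theorem natLog_le_logb (n : ℕ) : (Nat.log 2 n : ℝ) ≤ Real.logb 2 n := by
  exact_mod_cast Real.natLog_le_logb n 2

/-- For n ≥ 2 and ε ≤ 1, both 1/ε and log n are at most g, so the repetition factor, of order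
log(1/ε) + log log n, is O(log(2 + g)). One logarithmic factor suffices. -/
theorem isSoftO_queryCount :
    IsSoftO queryCount fun n ε => Real.logb 2 (n : ℝ) / ε ^ 2 := by
  refine ⟨2 ^ 34, 1, fun n ε hn hε => ?_⟩
  have hn' : (1 : ℝ) ≤ n := by exact_mod_cast hn
  simp only [pow_one]
  set g := Real.logb 2 (n : ℝ) / ε ^ 2 with hg
  have hlog0 : 0 ≤ Real.logb 2 (n : ℝ) := Real.logb_nonneg one_lt_two hn'
  have hg0 : 0 ≤ g := by positivity
  set l := Real.logb 2 (2 + g) with hl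
  have hl1 : 1 ≤ l := by
    rw [hl, Real.le_logb_iff_rpow_le one_lt_two (by positivity), Real.rpow_one]
    linarith
  unfold queryCount
  split_ifs with h
  swap
  · push_cast
    positivity
  obtain ⟨h2, hε1⟩ := h
  have hlog1 : 1 ≤ Real.logb 2 (n : ℝ) := by
    rw [Real.le_logb_iff_rpow_le one_lt_two (by positivity), Real.rpow_one]
    exact_mod_cast h2
  have hεsq : ε ^ 2 ≤ ε := by nlinarith
  have hεg : 1 / ε ≤ g := by
    rw [hg]
    exact div_le_div₀ hlog0 hlog1 (by positivity) hεsq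
  have hlogg : Real.logb 2 (n : ℝ) ≤ g := by
    rw [hg]
    exact le_div_self hlog0 (by positivity) (hεsq.trans hε1)
  have hK : (scales ε : ℝ) ≤ l + 2 := by
    have h3 : (scales ε : ℝ) ≤ Real.logb 2 (4 * (2 + g)) := by
      rw [Real.le_logb_iff_rpow_le one_lt_two (by positivity), Real.rpow_natCast]
      refine (two_pow_scales_le hε hε1).trans ?_
      have : 4 / ε = 4 * (1 / ε) := by ring
      linarith
    rw [Real.logb_mul (by norm_num) (by positivity)] at h3
    have h4 : Real.logb 2 4 = 2 := by
      rw [show (4 : ℝ) = 2 ^ (2 : ℝ) by norm_num]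
      exact Real.logb_rpow two_pos (by norm_num)
    linarith
  have hL : (Nat.clog 2 (Nat.log 2 n + 2) : ℝ) ≤ l + 1 := by
    refine (clog_le_logb_add_one (by omega)).trans ?_
    have : Real.logb 2 ((Nat.log 2 n + 2 : ℕ) : ℝ) ≤ l := by
      refine Real.logb_le_logb_of_le one_lt_two (by positivity) ?_
      push_cast
      linarith [natLog_le_logb n]
    linarith
  have hB : (repetitions n ε : ℝ) ≤ 18 * l := by
    unfold repetitions
    push_cast
    linarith
  have h4K : (4 : ℝ) ^ scales ε ≤ 16 / ε ^ 2 := by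
    have h3 := pow_le_pow_left₀ (by positivity) (two_pow_scales_le hε hε1) 2
    rw [← pow_mul, mul_comm, pow_mul, div_pow] at h3
    norm_num at h3 ⊢
    exact h3
  calc _ ≤ 2 ^ 24 * (repetitions n ε : ℝ) * 4 ^ scales ε * (1 + (Nat.log 2 n : ℕ)) :=
        totalQueries_le _ _ _
    _ ≤ 2 ^ 24 * (18 * l) * (16 / ε ^ 2) * (2 * Real.logb 2 n) := by
        gcongr
        linarith [natLog_le_logb n]
    _ = 2 ^ 24 * 576 * g * l := by
        rw [hg]
        ring
    _ ≤ 2 ^ 34 * g * l := by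
        gcongr
        norm_num

/-- The assumptions on ε and q stand behind the existential so that a tester can be chosen for every
input; where they fail, any tester serves. -/
theorem exists_tester_queryCount (n : ℕ) (ε : ℝ) (q : PMF (Fin n)) :
    ∃ A : Tester n (queryCount n ε), 0 < ε → linftyDistUniform q ≤ 1 / (100 * (n : ℝ)) →
      ∀ p : PMF (Fin n), (p = q → 2 / 3 ≤ A.run p true) ∧
        (ε ≤ tvDist p q → 2 / 3 ≤ A.run p false) := by
  by_cases h : 2 ≤ n ∧ ε ≤ 1
  · obtain ⟨h2, h1⟩ := h
    rw [queryCount, if_pos ⟨h2, h1⟩]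
    by_cases h' : 0 < ε ∧ linftyDistUniform q ≤ 1 / (100 * (n : ℝ))
    · obtain ⟨h0, hq⟩ := h'
      obtain ⟨A, hA, hA'⟩ := exists_tester (by omega) (nearUniform_of_linftyDistUniform_le hq)
        (scales_pos h0 h1) (le_refl (repetitions n ε)) (two_mul_half_pow_scales_le h0)
      refine ⟨A, fun _ _ p => ⟨?_, fun hp => ?_⟩⟩
      · rintro rfl
        exact two_thirds_le_apply (PMF.apply_ne_top _ _) hA
      · refine two_thirds_le_apply (PMF.apply_ne_top _ _) ?_
        have h3 := sum_toReal (A.run p)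
        rw [Fintype.sum_bool] at h3
        linarith [hA' p hp]
    · exact ⟨⟨PMF.pure fun _ => ⟨{⟨0, by omega⟩}, Finset.singleton_nonempty _⟩,
        fun _ _ => PMF.pure true⟩, fun h0 hq => (h' ⟨h0, hq⟩).elim⟩
  -- For n ≤ 1 or ε > 1 the far case is void, so accepting without queries is correct. For n = 1 it
  -- is forced, as g = 0.
  · rw [queryCount, if_neg h]
    refine ⟨⟨PMF.pure fun i => i.elim0, fun _ _ => PMF.pure true⟩, fun h0 _ p =>
      ⟨fun _ => ?_, fun hp => ?_⟩⟩
    · refine two_thirds_le_apply (PMF.apply_ne_top _ _) ?_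
      simp only [Tester.run, PMF.bind_const, PMF.pure_apply, if_true, ENNReal.toReal_one]
      norm_num
    · rcases not_and_or.mp h with h2 | h1
      · rw [tvDist_eq_zero_of_le_one (by omega)] at hp
        linarith
      · linarith [tvDist_le_one p q]

end NACOND

theorem theorem5 :
    ∃ m : ℕ → ℝ → ℕ,
      NACOND.IsSoftO m (fun n ε => Real.logb 2 (n : ℝ) / ε ^ 2) ∧
      ∃ A : (n : ℕ) → (ε : ℝ) → PMF (Fin n) → NACOND.Tester n (m n ε),
        ∀ (n : ℕ) (ε : ℝ), 0 < ε →
          ∀ q : PMF (Fin n), NACOND.linftyDistUniform q ≤ 1 / (100 * (n : ℝ)) →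
            ∀ p : PMF (Fin n),
              (p = q → 2 / 3 ≤ (A n ε q).run p true) ∧
              (ε ≤ NACOND.tvDist p q → 2 / 3 ≤ (A n ε q).run p false) := by
  choose A hA using NACOND.exists_tester_queryCount
  exact ⟨NACOND.queryCount, NACOND.isSoftO_queryCount, A, fun n ε hε q hq p => hA n ε q hε hq p⟩
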